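/- \textbf{Proposition (a.s. convergence of (VR-SPP)).} Let $(\Omega,\mathcal F,\mathbb P)$ be a probability space, let $\Phi(\mathbf x,\omega)\subseteq\mathbb R^n$ be a set for every $\mathbf x\in\mathbb R^n$ and $\omega\in\Omega$, and let $$T(\mathbf x)=\mathbb E[\Phi(\mathbf x,\omega)]=\Big\{\int f\,d\mathbb P \ :\ f \text{ integrable},\ f(\omega)\in\Phi(\mathbf x,\omega)\text{ a.s.}\Big\}$$ be its (Aumann) expectation. Assume that $T$ is maximal monotone and that the solution set $X^*=\{\mathbf x: 0\in T(\mathbf x)\}$ is nonempty. Assume that there is a stochastic first-order oracle for $T$ with state-dependent bounds: a jointly measurable $v:\mathbb R^n\times\Omega\to\mathbb R^n$ and constants $M_1,M_2$ such that, for every $\mathbf x\in\mathbb R^n$, $v(\mathbf x,\omega)\in\Phi(\mathbf x,\omega)$ a.s., $\mathbb E[v(\mathbf x,\omega)]\in T(\mathbf x)$ and $\mathbb E[\|v(\mathbf x,\omega)\|^2]\le M_1^2\|\mathbf x\|^2+M_2^2$. Fix $\lambda>0$, $a>1$, sample sizes $N_k=\lceil (k+1)^{2a}\rceil$ for all $k>0$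 (with $N_0$ arbitrary), and inner steplengths $\alpha_j=\theta/j$ for $j\ge 1$ (with $\alpha_0$ arbitrary), where $\theta>\lambda/2$. Let $\omega_{k,j}$ ($k,j\ge 0$) be independent samples with law $\mathbb P$. Given $\mathbf x^0\in\mathbb R^n$, let $\{\mathbf x^k\}$ be generated by the variance-reduced stochastic proximal-point scheme (VR-SPP): for $k\ge 0$ set $\mathbf z^k_0=\mathbf x^k$, $$\mathbf z^k_{j+1}=\mathbf z^k_j-\alpha_j\Big(v(\mathbf z^k_j,\omega_{k,j})+\tfrac1\lambda(\mathbf z^k_j-\mathbf x^k)\Big),\qquad j=0,\dots,N_k-1,$$ and $\mathbf x^{k+1}=\mathbf z^k_{N_k}$; that is, $\mathbf x^{k+1}=(I+\lambda T)^{-1}(\mathbf x^k)+e_k$, where $e_k$ is the error of the inexact resolvent computed by $N_k$ steps of stochastic approximation. Then, for every $\mathbf x^0\in\mathbb R^n$, almost surely the sequence $\{\mathbf x^k\}$ converges to a (possibly random) point of $X^*$. -/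

import Mathlib

open MeasureTheory ProbabilityTheory Filter Topology

/-- A set-valued map `T : E ⇉ E` is monotone. -/
def IsMonotoneMap {E : Type*} [NormedAddCommGroup E] [InnerProductSpace ℝ E]
    (T : E → Set E) : Prop :=
  ∀ ⦃x y u w : E⦄, u ∈ T x → w ∈ T y → 0 ≤ inner ℝ (u - w) (x - y)

/-- A set-valued map is maximal monotone: it is monotone, and every pair `(x, u)` that is
monotonically related to its whole graph already belongs to the graph (equivalently, the graph
is not properly contained in the graph of another monotone map). -/
def IsMaximalMonotoneMap {E : Type*} [NormedAddCommGroup E] [InnerProductSpace ℝ E]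
    (T : E → Set E) : Prop :=
  IsMonotoneMap T ∧
    ∀ x u : E, (∀ y w : E, w ∈ T y → 0 ≤ inner ℝ (u - w) (x - y)) → u ∈ T x

/-- The expectation (Aumann integral) of a random set `A`: the set of all expectations of
integrable selections of `A`. -/
def aumannExpectation {Ω E : Type*} [MeasurableSpace Ω] [NormedAddCommGroup E]
    [NormedSpace ℝ E] (P : Measure Ω) (A : Ω → Set E) : Set E :=
  {u | ∃ f : Ω → E, Integrable f P ∧ (∀ᵐ ω ∂P, f ω ∈ A ω) ∧ ∫ ω, f ω ∂P = u}

/-- The expectation-valued map `x ↦ 𝔼[Φ(x, ω)]`. -/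
def expectedMap {Ω E : Type*} [MeasurableSpace Ω] [NormedAddCommGroup E]
    [NormedSpace ℝ E] (P : Measure Ω) (Φ : E → Ω → Set E) : E → Set E :=
  fun x => aumannExpectation P (Φ x)

/-- `v` is a stochastic first-order oracle for `T = 𝔼[Φ(·, ω)]` with state-dependent bounds:
given `x` it produces `v(x, ω) ∈ Φ(x, ω)` with `𝔼[v(x, ω)] ∈ T(x)` and
`𝔼[‖v(x, ω)‖²] ≤ M₁² ‖x‖² + M₂²`. -/
structure IsStochasticOracle {Ω E : Type*} [MeasurableSpace Ω] [NormedAddCommGroup E]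
    [NormedSpace ℝ E] [MeasurableSpace E] (P : Measure Ω) (Φ : E → Ω → Set E)
    (v : E → Ω → E) (M₁ M₂ : ℝ) : Prop where
  measurable : Measurable (Function.uncurry v)
  selection : ∀ x, ∀ᵐ ω ∂P, v x ω ∈ Φ x ω
  memLp : ∀ x, MemLp (v x) 2 P
  mean_mem : ∀ x, ∫ ω, v x ω ∂P ∈ expectedMap P Φ x
  second_moment : ∀ x, ∫ ω, ‖v x ω‖ ^ 2 ∂P ≤ M₁ ^ 2 * ‖x‖ ^ 2 + M₂ ^ 2

/-- The inner stochastic approximation scheme, started at `z₀ = x` and driven by the samples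
`ξ 0, ξ 1, …`:
`z_{j+1} = z_j - α_j u_j`, where `u_j = v(z_j, ξ_j) + (z_j - x) / lam`.
It approximates the resolvent `(I + lam T)⁻¹ x`, the zero of `T(z) + (z - x) / lam`. -/
noncomputable def innerSA {Ω E : Type*} [NormedAddCommGroup E] [NormedSpace ℝ E]
    (v : E → Ω → E) (lam : ℝ) (α : ℕ → ℝ) (x : E) (ξ : ℕ → Ω) : ℕ → E
  | 0 => x
  | j + 1 =>
      innerSA v lam α x ξ j -
        α j • (v (innerSA v lam α x ξ j) (ξ j) + lam⁻¹ • (innerSA v lam α x ξ j - x))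

/-- The variance-reduced stochastic proximal-point scheme: `x^{k+1}` is the inexact resolvent of
`x^k` obtained after `N k` steps of the inner scheme started at `x^k`, the `j`-th of which uses
the sample `ξ k j`. -/
noncomputable def vrSPP {Ω E : Type*} [NormedAddCommGroup E] [NormedSpace ℝ E]
    (v : E → Ω → E) (lam : ℝ) (α : ℕ → ℝ) (N : ℕ → ℕ) (x₀ : E) (ξ : ℕ → ℕ → Ω) : ℕ → E
  | 0 => x₀
  | k + 1 => innerSA v lam α (vrSPP v lam α N x₀ ξ k) (ξ k) (N k)

/-!
The proof treats the scheme as an inexact proximal-point method and never needs a martingale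
convergence theorem.

The mean `g z = 𝔼[v z]` is a selection of the maximal monotone map `T` with linear growth. Averages
of the explicit iteration `z ↦ z - t (g z + (z - x) / lam)` solve the variational inequality of the
resolvent at `x` up to a small error, so compactness and maximality give a resolvent `J` defined
everywhere (`exists_resolvent`). It is firmly nonexpansive and its fixed points are the zeros of `T`.

Let `p` be a zero of `T`. As `T + (· - x) / lam` is strongly monotone with modulus `1 / lam` and the
second moment of the oracle grows quadratically, the mean square distance `u j` from the `j`-th
inner iterate to `J x` satisfies
`u (j + 1) ≤ (1 - (2 * θ / lam) / j + C / j ^ 2) * u j + C * D / j ^ 2`, where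
`D = 1 + 𝔼[‖x - p‖ ^ 2]`. Since `2 * θ / lam > 1`, this forces `u j ≤ K * D / j`
(`exists_rate_of_recursion`, `IsStochasticOracle.exists_innerSA_rate`). The independence of the next
sample from the past is used only through Fubini's theorem (`integral_le_of_indepFun`).

With `N k ≥ (k + 1) ^ (2 * a)` the error `e k` of the `k`-th resolvent therefore has second moment
at most `K * D k * (k + 1) ^ (-2 * a)`. Young's inequality with weight `(k + 1) ^ (-a)`, which is
summable because `a > 1`, bounds the second moments `D k` and then makes `𝔼[‖e k‖]` summable, so that
`∑ ‖e k‖` is almost surely finite (`IsStochasticOracle.ae_summable_error`). The rest is pathwise: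
with summable errors the distances to all fixed points of `J` converge, the residuals `x k - J (x k)`
tend to zero, and every cluster point is a fixed point and hence the limit
(`tendsto_of_summable_error`).
-/

/-! ### Resolvents of maximal monotone maps -/

section Resolvent

variable {E : Type*} [NormedAddCommGroup E] [InnerProductSpace ℝ E]

/-- Averages of the iterates `z - t • h z` of the selection `h z = g z + lam⁻¹ • (z - x)` of
`T + lam⁻¹ • (· - x)` solve, up to an arbitrarily small error, the variational inequality that characterizes the
resolvent at `x`. -/
lemma exists_approx_resolvent {T : E → Set E} (hT : IsMonotoneMap T) {g : E → E}
    (hg : ∀ z, g z ∈ T z) {A B : ℝ} (hA : 0 ≤ A) (hB : 0 ≤ B)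
    (hgrowth : ∀ z, ‖g z‖ ^ 2 ≤ A * ‖z‖ ^ 2 + B) {lam : ℝ} (hlam : 0 < lam) (x : E) :
    ∃ R : ℝ, ∀ δ : ℝ, 0 < δ → ∃ z : E, ‖z - x‖ ≤ R ∧ ∀ y w : E, w ∈ T y →
      inner ℝ (w + lam⁻¹ • (z - x)) (z - y) ≤ δ * (1 + ‖x - y‖ ^ 2) := by
  set h : E → E := fun z => g z + lam⁻¹ • (z - x) with hh
  -- linear growth of `h` around `x`
  obtain ⟨C, hC0, hC⟩ : ∃ C : ℝ, 0 < C ∧ ∀ z, ‖h z‖ ^ 2 ≤ C * (‖z - x‖ ^ 2 + 1) := by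
    refine ⟨4 * A + 2 * (A * (2 * ‖x‖ ^ 2) + B) + 2 * lam⁻¹ ^ 2 + 1, by positivity, fun z => ?_⟩
    have h1 : ‖h z‖ ^ 2 ≤ 2 * ‖g z‖ ^ 2 + 2 * (lam⁻¹ ^ 2 * ‖z - x‖ ^ 2) := by
      have := norm_add_le (g z) (lam⁻¹ • (z - x))
      rw [norm_smul, Real.norm_of_nonneg (by positivity)] at this
      calc ‖h z‖ ^ 2 ≤ (‖g z‖ + lam⁻¹ * ‖z - x‖) ^ 2 := by gcongr
        _ ≤ _ := by nlinarith [sq_nonneg (‖g z‖ - lam⁻¹ * ‖z - x‖)]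
    have h2 : ‖z‖ ^ 2 ≤ 2 * ‖z - x‖ ^ 2 + 2 * ‖x‖ ^ 2 := by
      have : ‖z‖ ≤ ‖z - x‖ + ‖x‖ := by simpa using norm_add_le (z - x) x
      calc ‖z‖ ^ 2 ≤ (‖z - x‖ + ‖x‖) ^ 2 := by gcongr
        _ ≤ _ := by nlinarith [sq_nonneg (‖z - x‖ - ‖x‖)]
    have h3 := mul_le_mul_of_nonneg_left h2 hA
    have h4 := hgrowth z
    have h5 : 0 ≤ (A * (2 * ‖x‖ ^ 2) + B) * ‖z - x‖ ^ 2 := by positivity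
    nlinarith [sq_nonneg lam⁻¹, sq_nonneg ‖z - x‖]
  set G := ‖g x‖ ^ 2 with hG
  have hG0 : 0 ≤ G := by positivity
  set R : ℝ := 2 * lam ^ 2 * G + 1 with hR
  have hR0 : 0 ≤ R := by positivity
  refine ⟨Real.sqrt R, fun δ hδ => ?_⟩
  set H : ℝ := C * (R + 1) with hH
  have hH0 : 0 < H := by positivity
  obtain ⟨t, ht0, ht1, ht2, ht3⟩ : ∃ t : ℝ, 0 < t ∧ t ≤ lam ∧ C * t ≤ (2 * lam)⁻¹ ∧ t * H ≤ δ := by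
    refine ⟨min lam (min ((2 * lam)⁻¹ / C) (δ / H)), by positivity, min_le_left _ _, ?_, ?_⟩
    · rw [mul_comm, ← le_div_iff₀ hC0]
      exact (min_le_right _ _).trans (min_le_left _ _)
    · rw [← le_div_iff₀ hH0]
      exact (min_le_right _ _).trans (min_le_right _ _)
  let z : ℕ → E := fun j => (fun y => y - t • h y)^[j] x
  have hz0 : z 0 = x := rfl
  have hz1 : ∀ j, z (j + 1) = z j - t • h (z j) := fun j => Function.iterate_succ_apply' _ _ _
  have hexp : ∀ j y, ‖z (j + 1) - y‖ ^ 2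
      = ‖z j - y‖ ^ 2 - 2 * t * inner ℝ (h (z j)) (z j - y) + t ^ 2 * ‖h (z j)‖ ^ 2 := by
    intro j y
    rw [hz1, sub_right_comm, norm_sub_sq_real, inner_smul_right, norm_smul,
      Real.norm_of_nonneg ht0.le, real_inner_comm]
    ring
  -- the ball of squared radius `R` around `x` is invariant under the iteration
  have hbd : ∀ j, ‖z j - x‖ ^ 2 ≤ R := by
    intro j
    induction j with
    | zero => simpa [hz0] using hR0
    | succ j ih =>
      have h1 : inner ℝ (h (z j)) (z j - x)
          ≥ (2 * lam)⁻¹ * ‖z j - x‖ ^ 2 - lam / 2 * G := by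
        have h2 := hT (hg (z j)) (hg x)
        rw [inner_sub_left] at h2
        have h3 : inner ℝ (h (z j)) (z j - x)
            = inner ℝ (g (z j)) (z j - x) + lam⁻¹ * ‖z j - x‖ ^ 2 := by
          simp only [hh, inner_add_left, inner_smul_left, real_inner_self_eq_norm_sq]
          simp
        have h4 : -(‖g x‖ * ‖z j - x‖) ≤ inner ℝ (g x) (z j - x) :=
          neg_le_of_abs_le (abs_real_inner_le_norm _ _)
        have h5 : ‖g x‖ * ‖z j - x‖ ≤ (2 * lam)⁻¹ * ‖z j - x‖ ^ 2 + lam / 2 * G := by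
          have : (2 * lam)⁻¹ * ‖z j - x‖ ^ 2 + lam / 2 * G - ‖g x‖ * ‖z j - x‖
              = (2 * lam)⁻¹ * (‖z j - x‖ - lam * ‖g x‖) ^ 2 := by
            rw [hG]; field_simp; ring
          have : 0 ≤ (2 * lam)⁻¹ * (‖z j - x‖ - lam * ‖g x‖) ^ 2 := by positivity
          linarith
        have h6 : lam⁻¹ = 2 * (2 * lam)⁻¹ := by field_simp
        rw [h6] at h3
        linarith
      have h2 := hexp j x
      have h3 := mul_le_mul_of_nonneg_left (hC (z j)) (sq_nonneg t)
      have h4 : ‖z (j + 1) - x‖ ^ 2 ≤ (1 - t * lam⁻¹ + C * t ^ 2) * ‖z j - x‖ ^ 2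
          + t * (lam * G + C * t) := by
        have h6 : lam⁻¹ = 2 * (2 * lam)⁻¹ := by field_simp
        have := mul_le_mul_of_nonneg_left h1 ht0.le
        rw [h6]
        nlinarith
      have h5 : 0 ≤ 1 - t * lam⁻¹ + C * t ^ 2 := by
        have : t * lam⁻¹ ≤ 1 := by rw [← div_eq_mul_inv, div_le_one hlam]; exact ht1
        nlinarith [sq_nonneg t]
      have h6 := mul_le_mul_of_nonneg_left ih h5
      have h7 : R * (lam⁻¹ - C * t) ≥ lam * G + C * t := by
        have h8 : R * (2 * lam)⁻¹ = lam * G + (2 * lam)⁻¹ := by rw [hR]; field_simp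
        have h9 : lam⁻¹ = 2 * (2 * lam)⁻¹ := by field_simp
        nlinarith
      nlinarith
  obtain ⟨m, hm⟩ := exists_nat_gt (1 / (2 * t * δ))
  have hm0 : (0 : ℝ) < m := lt_trans (by positivity) hm
  have hm1 : 1 ≤ 2 * t * m * δ := by
    rw [div_lt_iff₀ (by positivity)] at hm; linarith
  set zb : E := (m : ℝ)⁻¹ • ∑ j ∈ Finset.range m, z j with hzb
  have hsum : ∑ j ∈ Finset.range m, (z j - zb) = 0 := by
    rw [Finset.sum_sub_distrib, Finset.sum_const, Finset.card_range, ← Nat.cast_smul_eq_nsmul ℝ,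
      hzb, smul_inv_smul₀ hm0.ne', sub_self]
  refine ⟨zb, ?_, fun y w hw => ?_⟩
  · have h1 : zb - x = (m : ℝ)⁻¹ • ∑ j ∈ Finset.range m, (z j - x) := by
      rw [Finset.sum_sub_distrib, Finset.sum_const, Finset.card_range, ← Nat.cast_smul_eq_nsmul ℝ,
        smul_sub, inv_smul_smul₀ hm0.ne']
    rw [h1, norm_smul, Real.norm_of_nonneg (by positivity), inv_mul_le_iff₀ hm0]
    calc _ ≤ ∑ j ∈ Finset.range m, ‖z j - x‖ := norm_sum_le _ _
      _ ≤ ∑ j ∈ Finset.range m, Real.sqrt R :=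
        Finset.sum_le_sum fun j _ => Real.le_sqrt_of_sq_le (hbd j)
      _ = _ := by simp
  · set q : ℝ := inner ℝ (w + lam⁻¹ • (zb - x)) (zb - y) with hq
    -- telescoping estimate, with the convexity inequality at the average `zb`
    have hstep : ∀ j, 2 * t * (q + inner ℝ (w + lam⁻¹ • (zb - x) + lam⁻¹ • (zb - y)) (z j - zb))
        ≤ ‖z j - y‖ ^ 2 - ‖z (j + 1) - y‖ ^ 2 + t ^ 2 * H := by
      intro j
      have h1 := hexp j y
      have h2 : ‖h (z j)‖ ^ 2 ≤ H := (hC _).trans (by rw [hH]; gcongr; exact hbd j)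
      have h3 : q + inner ℝ (w + lam⁻¹ • (zb - x) + lam⁻¹ • (zb - y)) (z j - zb)
          ≤ inner ℝ (h (z j)) (z j - y) := by
        have h4 := hT (hg (z j)) hw
        have h5 : inner ℝ (h (z j)) (z j - y) - (q + inner ℝ (w + lam⁻¹ • (zb - x)
            + lam⁻¹ • (zb - y)) (z j - zb))
            = inner ℝ (g (z j) - w) (z j - y) + lam⁻¹ * ‖z j - zb‖ ^ 2 := by
          rw [← real_inner_self_eq_norm_sq, hq]
          simp only [hh, inner_add_left, inner_sub_left, inner_sub_right, real_inner_smul_left]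
          have e1 := real_inner_comm (z j) zb
          have e2 := real_inner_comm y zb
          have e3 := real_inner_comm y (z j)
          rw [e1, e2, e3]
          ring
        have : 0 ≤ lam⁻¹ * ‖z j - zb‖ ^ 2 := by positivity
        linarith
      have h6 := mul_le_mul_of_nonneg_left h3 (by positivity : 0 ≤ 2 * t)
      have h7 := mul_le_mul_of_nonneg_left h2 (sq_nonneg t)
      linarith
    have hs := Finset.sum_le_sum fun j (_ : j ∈ Finset.range m) => hstep j
    rw [← Finset.mul_sum, Finset.sum_add_distrib, ← inner_sum (𝕜 := ℝ) (Finset.range m)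
      (fun j => z j - zb), hsum, inner_zero_right, Finset.sum_add_distrib, Finset.sum_range_sub'] at hs
    simp only [Finset.sum_const, Finset.card_range, nsmul_eq_mul, hz0] at hs
    have h8 : 2 * t * m * q ≤ ‖x - y‖ ^ 2 + m * (t ^ 2 * H) := by
      nlinarith [sq_nonneg ‖z m - y‖]
    have h9 : m * (t ^ 2 * H) ≤ m * t * δ := by
      have := mul_le_mul_of_nonneg_left ht3 (by positivity : 0 ≤ m * t)
      linarith
    have h10 : ‖x - y‖ ^ 2 ≤ 2 * t * m * δ * ‖x - y‖ ^ 2 :=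
      le_mul_of_one_le_left (sq_nonneg _) hm1
    have h11 : 2 * t * m * q ≤ 2 * t * m * (δ * (1 + ‖x - y‖ ^ 2)) := by
      nlinarith [mul_pos (mul_pos hm0 ht0) hδ]
    exact le_of_mul_le_mul_left h11 (by positivity)

/-- Minty's theorem for maximal monotone maps having a selection of linear growth. -/
lemma exists_resolvent [FiniteDimensional ℝ E] {T : E → Set E} (hT : IsMaximalMonotoneMap T)
    {g : E → E} (hg : ∀ z, g z ∈ T z) {A B : ℝ} (hA : 0 ≤ A) (hB : 0 ≤ B)
    (hgrowth : ∀ z, ‖g z‖ ^ 2 ≤ A * ‖z‖ ^ 2 + B) {lam : ℝ} (hlam : 0 < lam) (x : E) :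
    ∃ z : E, lam⁻¹ • (x - z) ∈ T z := by
  obtain ⟨R, hR⟩ := exists_approx_resolvent hT.1 hg hA hB hgrowth hlam x
  choose z hz1 hz2 using fun m : ℕ => hR (1 / ((m : ℝ) + 1)) (by positivity)
  obtain ⟨zb, -, φ, hφ, hlim⟩ := tendsto_subseq_of_bounded
    (Metric.isBounded_closedBall (x := x) (r := R))
    (fun m => by simpa [dist_eq_norm] using hz1 m)
  refine ⟨zb, hT.2 _ _ fun y w hw => ?_⟩
  have h1 : Tendsto (fun m => inner ℝ (w + lam⁻¹ • (z (φ m) - x)) (z (φ m) - y)) atTop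
      (𝓝 (inner ℝ (w + lam⁻¹ • (zb - x)) (zb - y))) := by
    have hc : Continuous fun u : E => inner ℝ (w + lam⁻¹ • (u - x)) (u - y) := by fun_prop
    exact (hc.tendsto zb).comp hlim
  have h2 : Tendsto (fun m => 1 / ((φ m : ℝ) + 1) * (1 + ‖x - y‖ ^ 2)) atTop (𝓝 0) := by
    have := ((tendsto_one_div_add_atTop_nhds_zero_nat (𝕜 := ℝ)).comp hφ.tendsto_atTop).mul_const
      (1 + ‖x - y‖ ^ 2)
    rwa [zero_mul] at this
  have h3 := le_of_tendsto_of_tendsto' h1 h2 fun m => hz2 (φ m) y w hw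
  have h4 : lam⁻¹ • (x - zb) - w = -(w + lam⁻¹ • (zb - x)) := by
    rw [← neg_sub zb x, smul_neg]; abel
  rw [h4, inner_neg_left]
  linarith

/-- The resolvent of a monotone map is firmly nonexpansive. -/
lemma resolvent_firmly_nonexpansive {T : E → Set E} (hT : IsMonotoneMap T) {lam : ℝ}
    (hlam : 0 < lam) {J : E → E} (hJ : ∀ x, lam⁻¹ • (x - J x) ∈ T (J x)) (x y : E) :
    ‖J x - J y‖ ^ 2 + ‖(x - J x) - (y - J y)‖ ^ 2 ≤ ‖x - y‖ ^ 2 := by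
  have h1 := hT (hJ x) (hJ y)
  rw [← smul_sub, real_inner_smul_left] at h1
  have h2 : 0 ≤ inner ℝ ((x - J x) - (y - J y)) (J x - J y) :=
    nonneg_of_mul_nonneg_right h1 (inv_pos.2 hlam)
  have h3 : x - y = (x - J x - (y - J y)) + (J x - J y) := by abel
  rw [h3, norm_add_sq_real]
  linarith

lemma resolvent_eq_self_iff {T : E → Set E} (hT : IsMonotoneMap T) {lam : ℝ}
    (hlam : 0 < lam) {J : E → E} (hJ : ∀ x, lam⁻¹ • (x - J x) ∈ T (J x)) (x : E) :
    J x = x ↔ 0 ∈ T x := by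
  constructor
  · intro h
    simpa [h] using hJ x
  · intro h
    have h1 := hT (hJ x) h
    rw [sub_zero, real_inner_smul_left, ← neg_sub (J x) x, inner_neg_left,
      real_inner_self_eq_norm_sq] at h1
    have h2 : 0 ≤ -‖J x - x‖ ^ 2 := nonneg_of_mul_nonneg_right h1 (inv_pos.2 hlam)
    have h3 : ‖J x - x‖ = 0 := by nlinarith [norm_nonneg (J x - x)]
    exact sub_eq_zero.1 (norm_eq_zero.1 h3)

end Resolvent

lemma norm_sub_le_of_firmly_nonexpansive {E : Type*} [SeminormedAddCommGroup E] {J : E → E}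
    (hJ : ∀ x y, ‖J x - J y‖ ^ 2 + ‖(x - J x) - (y - J y)‖ ^ 2 ≤ ‖x - y‖ ^ 2) (x y : E) :
    ‖J x - J y‖ ≤ ‖x - y‖ :=
  le_of_sq_le_sq (by linarith [hJ x y, sq_nonneg ‖(x - J x) - (y - J y)‖]) (norm_nonneg _)

lemma continuous_of_firmly_nonexpansive {E : Type*} [SeminormedAddCommGroup E] {J : E → E}
    (hJ : ∀ x y, ‖J x - J y‖ ^ 2 + ‖(x - J x) - (y - J y)‖ ^ 2 ≤ ‖x - y‖ ^ 2) : Continuous J :=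
  (LipschitzWith.mk_one fun x y => by
    simpa only [dist_eq_norm] using norm_sub_le_of_firmly_nonexpansive hJ x y).continuous

/-! ### Recursions and inexact fixed-point iterations -/

lemma exists_tendsto_of_le_add_summable {a ε : ℕ → ℝ} (ha : ∀ k, 0 ≤ a k) (hε : ∀ k, 0 ≤ ε k)
    (hsum : Summable ε) (h : ∀ k, a (k + 1) ≤ a k + ε k) : ∃ l, Tendsto a atTop (𝓝 l) := by
  have hanti : Antitone fun k => a k - ∑ i ∈ Finset.range k, ε i :=
    antitone_nat_of_succ_le fun k => by
      rw [Finset.sum_range_succ]; linarith [h k]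
  have hbdd : BddBelow (Set.range fun k => a k - ∑ i ∈ Finset.range k, ε i) := by
    refine ⟨-∑' i, ε i, ?_⟩
    rintro _ ⟨k, rfl⟩
    have := hsum.sum_le_tsum (Finset.range k) fun i _ => hε i
    have := ha k
    simp only
    linarith
  have h1 := (tendsto_atTop_ciInf hanti hbdd).add hsum.hasSum.tendsto_sum_nat
  exact ⟨_, by simpa using h1⟩

/-- A linear recursion with factor `1 - c / j + O(1 / j ^ 2)`, `c > 1`, and
inhomogeneity `O(1 / j ^ 2)` has solutions of size `O(1 / j)`; the constant `K` depends only on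
`c` and `C`, not on the scale `D` of the solution. -/
lemma exists_rate_of_recursion {c C : ℝ} (hc : 1 < c) (hC : 0 ≤ C) :
    ∃ K : ℝ, 0 ≤ K ∧ ∀ D : ℝ, 0 ≤ D → ∀ u : ℕ → ℝ, (∀ j, 0 ≤ u j) → u 1 ≤ C * D →
      (∀ j : ℕ, 1 ≤ j →
        u (j + 1) ≤ (1 - c / j + C / (j : ℝ) ^ 2) * u j + C / (j : ℝ) ^ 2 * D) →
      ∀ j : ℕ, 1 ≤ j → u j ≤ K * D / j := by
  obtain ⟨m, hm⟩ := exists_nat_gt (c + 2 * C / (c - 1))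
  have hc1 : 0 < c - 1 := by linarith
  have hm1 : c ≤ m := by
    have : 0 ≤ 2 * C / (c - 1) := by positivity
    linarith
  have hm2 : 2 * C ≤ m * (c - 1) := by
    rw [← div_le_iff₀ hc1]; linarith
  have hm0 : (0 : ℝ) < m := by linarith
  have hmn : 1 ≤ m := by exact_mod_cast hm0
  set K : ℝ := m * (1 + C) ^ m + 2 * C / (c - 1) with hK
  refine ⟨K, by positivity, fun D hD u hu hu1 hrec => ?_⟩
  have hcrude : ∀ j : ℕ, 1 ≤ j → u j + D ≤ (1 + C) ^ j * D := by
    intro j hj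
    induction j, hj using Nat.le_induction with
    | base => rw [pow_one]; linarith
    | succ j hj ih =>
      have hj' : (1 : ℝ) ≤ j := by exact_mod_cast hj
      have h1 : C / (j : ℝ) ^ 2 ≤ C := div_le_self hC (one_le_pow₀ hj')
      have h2 : 0 ≤ c / (j : ℝ) := by positivity
      have h3 : (1 - c / j + C / (j : ℝ) ^ 2) * u j ≤ (1 + C) * u j :=
        mul_le_mul_of_nonneg_right (by linarith) (hu j)
      have h4 : C / (j : ℝ) ^ 2 * D ≤ C * D := mul_le_mul_of_nonneg_right h1 hD
      have h5 := mul_le_mul_of_nonneg_left ih (by linarith : 0 ≤ 1 + C)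
      rw [pow_succ']
      linarith [hrec j hj]
  have hsmall : ∀ j : ℕ, 1 ≤ j → j ≤ m → u j ≤ K * D / j := by
    intro j hj hjm
    have hj' : (0 : ℝ) < j := by exact_mod_cast hj
    rw [le_div_iff₀ hj']
    have h1 : u j ≤ (1 + C) ^ m * D := by
      have := hcrude j hj
      have h2 : (1 + C) ^ j * D ≤ (1 + C) ^ m * D := by
        gcongr; linarith
      linarith
    have h3 : (j : ℝ) ≤ m := by exact_mod_cast hjm
    have h4 : 0 ≤ 2 * C / (c - 1) * D := by positivity
    calc u j * j ≤ (1 + C) ^ m * D * m := by gcongr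
      _ ≤ K * D := by rw [hK]; nlinarith
  intro j hj
  by_cases hjm : j ≤ m
  · exact hsmall j hj hjm
  · replace hjm : m ≤ j := by omega
    induction j, hjm using Nat.le_induction with
    | base => exact hsmall m hmn le_rfl
    | succ j hjm ih =>
      have hj1 : 1 ≤ j := hmn.trans hjm
      have ihj : u j ≤ K * D / j := ih hj1
      have hj0 : (0 : ℝ) < j := by exact_mod_cast hj1
      have hjm' : (m : ℝ) ≤ j := by exact_mod_cast hjm
      have h1 : 0 ≤ 1 - c / j + C / (j : ℝ) ^ 2 := by
        have : c / j ≤ 1 := by rw [div_le_one hj0]; linarith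
        have : 0 ≤ C / (j : ℝ) ^ 2 := by positivity
        linarith
      have h2 := mul_le_mul_of_nonneg_left ihj h1
      have hKC : C ≤ K * ((c - 1) / 2) := by
        have h5 : 2 * C / (c - 1) * ((c - 1) / 2) = C := by field_simp
        have h6 : 0 ≤ m * (1 + C) ^ m * ((c - 1) / 2) := by positivity
        rw [hK, add_mul]; linarith
      have hK0 : 0 ≤ K := by positivity
      have hCj : C / j ≤ (c - 1) / 2 := by
        rw [div_le_iff₀ hj0]
        nlinarith
      have h3 : (1 - c / j + C / (j : ℝ) ^ 2) * (K * D / j) + C / (j : ℝ) ^ 2 * D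
          ≤ K * D / ((j + 1 : ℕ) : ℝ) := by
        have h7 : K * D / ((j + 1 : ℕ) : ℝ)
            - ((1 - c / j + C / (j : ℝ) ^ 2) * (K * D / j) + C / (j : ℝ) ^ 2 * D)
            = (K * ((c - 1 - C / j) + 1 / (j + 1)) - C) * (D / (j : ℝ) ^ 2) := by
          push_cast
          field_simp
          ring
        have h8 : 0 ≤ K * ((c - 1 - C / j) + 1 / (j + 1)) - C := by
          have h9 : (c - 1) / 2 ≤ (c - 1 - C / j) + 1 / ((j : ℝ) + 1) := by
            have : 0 ≤ 1 / ((j : ℝ) + 1) := by positivity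
            linarith
          have := mul_le_mul_of_nonneg_left h9 hK0
          linarith
        have := mul_nonneg h8 (by positivity : 0 ≤ D / (j : ℝ) ^ 2)
        linarith
      linarith [hrec j hj1]

lemma bounded_of_le_one_add_mul {D s : ℕ → ℝ} (hs : ∀ k, 0 ≤ s k) (hsum : Summable s)
    (hD : 0 ≤ D 0) (h : ∀ k, D (k + 1) ≤ (1 + s k) * D k) : ∃ B, ∀ k, D k ≤ B := by
  refine ⟨Real.exp (∑' i, s i) * D 0, fun k => ?_⟩
  have h1 : D k ≤ Real.exp (∑ i ∈ Finset.range k, s i) * D 0 := by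
    induction k with
    | zero => simp
    | succ k ih =>
      calc D (k + 1) ≤ (1 + s k) * D k := h k
        _ ≤ (1 + s k) * (Real.exp (∑ i ∈ Finset.range k, s i) * D 0) :=
          mul_le_mul_of_nonneg_left ih (by linarith [hs k])
        _ ≤ Real.exp (s k) * (Real.exp (∑ i ∈ Finset.range k, s i) * D 0) := by
          gcongr
          linarith [Real.add_one_le_exp (s k)]
        _ = _ := by rw [Finset.sum_range_succ, Real.exp_add]; ring
  refine h1.trans ?_
  gcongr
  exact hsum.sum_le_tsum _ fun i _ => hs i

/-- The inexact proximal-point iteration with summable errors converges, for a firmly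
nonexpansive map with a fixed point. -/
lemma tendsto_of_summable_error {E : Type*} [NormedAddCommGroup E] [InnerProductSpace ℝ E]
    [FiniteDimensional ℝ E] {J : E → E}
    (hJ : ∀ x y, ‖J x - J y‖ ^ 2 + ‖(x - J x) - (y - J y)‖ ^ 2 ≤ ‖x - y‖ ^ 2)
    {p : E} (hp : J p = p) {x : ℕ → E} (hx : Summable fun k => ‖x (k + 1) - J (x k)‖) :
    ∃ q, J q = q ∧ Tendsto x atTop (𝓝 q) := by
  have hne := norm_sub_le_of_firmly_nonexpansive hJ
  have hcont := continuous_of_firmly_nonexpansive hJ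
  have hle : ∀ y k, ‖x (k + 1) - y‖ ≤ ‖J (x k) - y‖ + ‖x (k + 1) - J (x k)‖ := fun y k =>
    (norm_sub_le_norm_sub_add_norm_sub _ _ _).trans_eq (add_comm _ _)
  -- distances to fixed points converge
  have hfejer : ∀ y, J y = y → ∃ l, Tendsto (fun k => ‖x k - y‖) atTop (𝓝 l) := fun y hy =>
    exists_tendsto_of_le_add_summable (fun _ => norm_nonneg _) (fun _ => norm_nonneg _) hx
      fun k => (hle y k).trans (by
        have := hne (x k) y
        rw [hy] at this
        linarith)
  obtain ⟨l, hl⟩ := hfejer p hp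
  have hJl : Tendsto (fun k => ‖J (x k) - p‖) atTop (𝓝 l) := by
    refine tendsto_of_tendsto_of_tendsto_of_le_of_le
      (g := fun k => ‖x (k + 1) - p‖ - ‖x (k + 1) - J (x k)‖) ?_ hl
      (fun k => by have := hle p k; simp only; linarith)
      (fun k => by have := hne (x k) p; rwa [hp] at this)
    simpa using (hl.comp (tendsto_add_atTop_nat 1)).sub hx.tendsto_atTop_zero
  have hres : Tendsto (fun k => ‖x k - J (x k)‖ ^ 2) atTop (𝓝 0) := by
    refine squeeze_zero (fun k => sq_nonneg _)
      (g := fun k => ‖x k - p‖ ^ 2 - ‖J (x k) - p‖ ^ 2) (fun k => ?_) ?_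
    · have := hJ (x k) p
      rw [hp, sub_self, sub_zero] at this
      linarith
    · simpa using (hl.pow 2).sub (hJl.pow 2)
  obtain ⟨r, hr⟩ := hl.bddAbove_range
  obtain ⟨q, -, φ, hφ, hlim⟩ := tendsto_subseq_of_bounded
    (Metric.isBounded_closedBall (x := p) (r := r))
    (fun k => by simpa [dist_eq_norm] using hr (Set.mem_range_self k))
  have hq : J q = q := by
    have h1 : Tendsto (fun k => ‖x (φ k) - J (x (φ k))‖ ^ 2) atTop (𝓝 (‖q - J q‖ ^ 2)) :=
      ((hlim.sub ((hcont.tendsto q).comp hlim)).norm).pow 2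
    have h2 := tendsto_nhds_unique h1 (hres.comp hφ.tendsto_atTop)
    exact (sub_eq_zero.1 (by simpa using h2)).symm
  refine ⟨q, hq, ?_⟩
  obtain ⟨l', hl'⟩ := hfejer q hq
  have h3 : Tendsto (fun k => ‖x (φ k) - q‖) atTop (𝓝 0) :=
    tendsto_iff_norm_sub_tendsto_zero.1 hlim
  rw [tendsto_nhds_unique (hl'.comp hφ.tendsto_atTop) h3] at hl'
  exact tendsto_iff_norm_sub_tendsto_zero.2 hl'

/-! ### The oracle -/

lemma norm_integral_sq_le {Ω E : Type*} [MeasurableSpace Ω] [NormedAddCommGroup E]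
    [InnerProductSpace ℝ E] {P : Measure Ω} [IsProbabilityMeasure P] {f : Ω → E} (hf : MemLp f 2 P) :
    ‖∫ ω, f ω ∂P‖ ^ 2 ≤ ∫ ω, ‖f ω‖ ^ 2 ∂P := by
  have hi : Integrable f P := hf.integrable (by norm_num)
  have h2 : Integrable (fun ω => ‖f ω‖ ^ 2) P := (memLp_two_iff_integrable_sq_norm hf.1).1 hf
  set m : ℝ := ∫ ω, ‖f ω‖ ∂P with hm
  have h3 : ‖∫ ω, f ω ∂P‖ ≤ m := norm_integral_le_integral_norm f
  have h4 : 0 ≤ ∫ ω, (‖f ω‖ - m) ^ 2 ∂P := integral_nonneg fun ω => sq_nonneg _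
  have h5 : ∫ ω, (‖f ω‖ - m) ^ 2 ∂P = (∫ ω, ‖f ω‖ ^ 2 ∂P) - m ^ 2 := by
    have : (fun ω => (‖f ω‖ - m) ^ 2) = fun ω => ‖f ω‖ ^ 2 - 2 * m * ‖f ω‖ + m ^ 2 := by
      funext ω; ring
    have hs : Integrable (fun ω => ‖f ω‖ ^ 2 - 2 * m * ‖f ω‖) P := h2.sub (hi.norm.const_mul _)
    rw [this, integral_add hs (integrable_const _),
      integral_sub h2 (hi.norm.const_mul _), integral_const_mul, ← hm]
    simp; ring
  have : ‖∫ ω, f ω ∂P‖ ^ 2 ≤ m ^ 2 := by gcongr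
  linarith

section Oracle

variable {Ω E : Type*} [MeasurableSpace Ω] [NormedAddCommGroup E] [InnerProductSpace ℝ E]
  [MeasurableSpace E] {P : Measure Ω} [IsProbabilityMeasure P] {Φ : E → Ω → Set E} {v : E → Ω → E} {M₁ M₂ : ℝ}

/-- The resolvent of the expected map is everywhere defined. -/
lemma IsStochasticOracle.exists_resolvent [FiniteDimensional ℝ E]
    (hv : IsStochasticOracle P Φ v M₁ M₂)
    (hT : IsMaximalMonotoneMap (expectedMap P Φ)) {lam : ℝ} (hlam : 0 < lam) (x : E) :
    ∃ z : E, lam⁻¹ • (x - z) ∈ expectedMap P Φ z :=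
  _root_.exists_resolvent hT hv.mean_mem (sq_nonneg M₁) (sq_nonneg M₂)
    (fun z => (norm_integral_sq_le (hv.memLp z)).trans (hv.second_moment z)) hlam x

/-- The stochastic direction of the inner scheme has a second moment of quadratic growth. -/
lemma IsStochasticOracle.exists_second_moment_direction (hv : IsStochasticOracle P Φ v M₁ M₂)
    {J : E → E} {p : E} (hJp : ∀ x, ‖J x - p‖ ≤ ‖x - p‖) (lam : ℝ) :
    ∃ C : ℝ, 0 ≤ C ∧ ∀ x z, ∫ ω, ‖v z ω + lam⁻¹ • (z - x)‖ ^ 2 ∂P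
      ≤ C * (‖z - J x‖ ^ 2 + (1 + ‖x - p‖ ^ 2)) := by
  refine ⟨2 * M₁ ^ 2 * 3 * (1 + ‖p‖ ^ 2) + 2 * M₂ ^ 2 + 2 * lam⁻¹ ^ 2 * 8,
    by positivity, fun x z => ?_⟩
  have hmem := hv.memLp z
  have h2 : Integrable (fun ω => ‖v z ω‖ ^ 2) P :=
    (memLp_two_iff_integrable_sq_norm hmem.1).1 hmem
  have h1 : ∫ ω, ‖v z ω + lam⁻¹ • (z - x)‖ ^ 2 ∂P
      ≤ ∫ ω, (2 * ‖v z ω‖ ^ 2 + 2 * (lam⁻¹ ^ 2 * ‖z - x‖ ^ 2)) ∂P := by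
    refine integral_mono_of_nonneg (ae_of_all _ fun ω => sq_nonneg _)
      ((h2.const_mul _).add (integrable_const _)) (ae_of_all _ fun ω => ?_)
    have h3 := norm_add_le (v z ω) (lam⁻¹ • (z - x))
    have h4 : lam⁻¹ ^ 2 * ‖z - x‖ ^ 2 = ‖lam⁻¹ • (z - x)‖ ^ 2 := by
      rw [norm_smul, mul_pow, Real.norm_eq_abs, sq_abs]
    simp only [h4]
    calc ‖v z ω + lam⁻¹ • (z - x)‖ ^ 2 ≤ (‖v z ω‖ + ‖lam⁻¹ • (z - x)‖) ^ 2 := by gcongr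
      _ ≤ _ := by nlinarith [sq_nonneg (‖v z ω‖ - ‖lam⁻¹ • (z - x)‖)]
  rw [integral_add (h2.const_mul _) (integrable_const _), integral_const_mul] at h1
  simp only [integral_const, probReal_univ, one_smul] at h1
  set r := ‖z - J x‖ with hr
  set d := ‖x - p‖ with hd
  have hz : ‖z‖ ^ 2 ≤ 3 * (r ^ 2 + d ^ 2 + ‖p‖ ^ 2) := by
    have h5 : ‖z‖ ≤ r + d + ‖p‖ := by
      calc ‖z‖ = ‖(z - J x) + (J x - p) + p‖ := by congr 1; abel
        _ ≤ ‖z - J x‖ + ‖J x - p‖ + ‖p‖ := norm_add₃_le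
        _ ≤ _ := by gcongr; exact hJp x
    calc ‖z‖ ^ 2 ≤ (r + d + ‖p‖) ^ 2 := by gcongr
      _ ≤ _ := by nlinarith [sq_nonneg (r - d), sq_nonneg (r - ‖p‖), sq_nonneg (d - ‖p‖)]
  have hzx : ‖z - x‖ ^ 2 ≤ 8 * (r ^ 2 + d ^ 2) := by
    have h5 : ‖z - x‖ ≤ r + 2 * d := by
      calc ‖z - x‖ = ‖(z - J x) + (J x - p) + (p - x)‖ := by congr 1; abel
        _ ≤ ‖z - J x‖ + ‖J x - p‖ + ‖p - x‖ := norm_add₃_le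
        _ ≤ r + 2 * d := by
          rw [norm_sub_rev p x]; linarith [hJp x]
    calc ‖z - x‖ ^ 2 ≤ (r + 2 * d) ^ 2 := by gcongr
      _ ≤ _ := by nlinarith [sq_nonneg (2 * r - d)]
  have h6 := hv.second_moment z
  have h7 : M₁ ^ 2 * ‖z‖ ^ 2 ≤ M₁ ^ 2 * 3 * (1 + ‖p‖ ^ 2) * (r ^ 2 + (1 + d ^ 2)) := by
    calc _ ≤ M₁ ^ 2 * (3 * (r ^ 2 + d ^ 2 + ‖p‖ ^ 2)) := by gcongr
      _ ≤ M₁ ^ 2 * (3 * ((1 + ‖p‖ ^ 2) * (r ^ 2 + (1 + d ^ 2)))) := by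
        gcongr
        have : 0 ≤ ‖p‖ ^ 2 * (r ^ 2 + d ^ 2) := by positivity
        linarith
      _ = _ := by ring
  have h8 : M₂ ^ 2 ≤ M₂ ^ 2 * (r ^ 2 + (1 + d ^ 2)) :=
    le_mul_of_one_le_right (sq_nonneg _) (by nlinarith [sq_nonneg r, sq_nonneg d])
  have h9 : lam⁻¹ ^ 2 * ‖z - x‖ ^ 2 ≤ lam⁻¹ ^ 2 * (8 * (r ^ 2 + (1 + d ^ 2))) := by
    gcongr; linarith
  linarith

lemma IsStochasticOracle.memLp_direction (hv : IsStochasticOracle P Φ v M₁ M₂) (z w : E) :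
    MemLp (fun ω => v z ω + w) 2 P :=
  (hv.memLp z).add (memLp_const w)

/-- One step of stochastic approximation from `z`, centred at the resolvent `J x`: the strong
monotonicity of `T + lam⁻¹ • (· - x)` contracts the squared distance on average. -/
lemma IsStochasticOracle.integral_step_le [CompleteSpace E]
    (hv : IsStochasticOracle P Φ v M₁ M₂)
    (hT : IsMonotoneMap (expectedMap P Φ)) {lam : ℝ} {J : E → E}
    (hJ : ∀ x, lam⁻¹ • (x - J x) ∈ expectedMap P Φ (J x)) {p : E} {C : ℝ}
    (hC : ∀ x z, ∫ ω, ‖v z ω + lam⁻¹ • (z - x)‖ ^ 2 ∂P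
      ≤ C * (‖z - J x‖ ^ 2 + (1 + ‖x - p‖ ^ 2))) {t : ℝ} (ht : 0 ≤ t) (x z : E) :
    ∫ ω, ‖z - t • (v z ω + lam⁻¹ • (z - x)) - J x‖ ^ 2 ∂P
      ≤ (1 - 2 * t / lam + C * t ^ 2) * ‖z - J x‖ ^ 2 + C * t ^ 2 * (1 + ‖x - p‖ ^ 2) := by
  have hm := hv.memLp_direction z (lam⁻¹ • (z - x))
  have hi : Integrable (fun ω => v z ω + lam⁻¹ • (z - x)) P := hm.integrable (by norm_num)
  have h2 := (memLp_two_iff_integrable_sq_norm hm.1).1 hm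
  have h3 : (fun ω => ‖z - t • (v z ω + lam⁻¹ • (z - x)) - J x‖ ^ 2)
      = fun ω => ‖z - J x‖ ^ 2 - 2 * t * inner ℝ (z - J x) (v z ω + lam⁻¹ • (z - x))
        + t ^ 2 * ‖v z ω + lam⁻¹ • (z - x)‖ ^ 2 := by
    funext ω
    rw [sub_right_comm, norm_sub_sq_real, real_inner_smul_right, norm_smul,
      Real.norm_of_nonneg ht]
    ring
  have hi' := (hi.const_inner (𝕜 := ℝ) (z - J x)).const_mul (2 * t)
  have hs : Integrable (fun ω => ‖z - J x‖ ^ 2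
      - 2 * t * inner ℝ (z - J x) (v z ω + lam⁻¹ • (z - x))) P := (integrable_const _).sub hi'
  rw [h3, integral_add hs (h2.const_mul _),
    integral_sub (integrable_const _) hi', integral_const_mul, integral_const_mul,
    integral_inner hi, integral_add (hv.memLp z |>.integrable (by norm_num)) (integrable_const _)]
  simp only [integral_const, probReal_univ, one_smul]
  have h4 := hT (hv.mean_mem z) (hJ x)
  have h5 : inner ℝ (z - J x) ((∫ ω, v z ω ∂P) + lam⁻¹ • (z - x))
      = inner ℝ ((∫ ω, v z ω ∂P) - lam⁻¹ • (x - J x)) (z - J x) + lam⁻¹ * ‖z - J x‖ ^ 2 := by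
    rw [← real_inner_self_eq_norm_sq, ← real_inner_smul_left, ← inner_add_left, real_inner_comm]
    congr 1
    simp only [smul_sub]; abel
  have h6 : 2 * t / lam = 2 * t * lam⁻¹ := div_eq_mul_inv _ _
  have h7 := mul_le_mul_of_nonneg_left (hC x z) (sq_nonneg t)
  have h8 := mul_nonneg (by positivity : 0 ≤ 2 * t) h4
  rw [h5, h6]
  linarith

/-- A bound for one step of stochastic approximation with a steplength of any sign. -/
lemma IsStochasticOracle.integral_step_le_crude (hv : IsStochasticOracle P Φ v M₁ M₂)
    {lam : ℝ} {J : E → E} {p : E} {C : ℝ}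
    (hC : ∀ x z, ∫ ω, ‖v z ω + lam⁻¹ • (z - x)‖ ^ 2 ∂P
      ≤ C * (‖z - J x‖ ^ 2 + (1 + ‖x - p‖ ^ 2))) (t : ℝ) (x z : E) :
    ∫ ω, ‖z - t • (v z ω + lam⁻¹ • (z - x)) - J x‖ ^ 2 ∂P
      ≤ (2 + 2 * t ^ 2 * C) * ‖z - J x‖ ^ 2 + 2 * t ^ 2 * C * (1 + ‖x - p‖ ^ 2) := by
  have hm := hv.memLp_direction z (lam⁻¹ • (z - x))
  have h2 := (memLp_two_iff_integrable_sq_norm hm.1).1 hm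
  have h3 : ∫ ω, ‖z - t • (v z ω + lam⁻¹ • (z - x)) - J x‖ ^ 2 ∂P
      ≤ ∫ ω, (2 * ‖z - J x‖ ^ 2 + 2 * t ^ 2 * ‖v z ω + lam⁻¹ • (z - x)‖ ^ 2) ∂P := by
    refine integral_mono_of_nonneg (ae_of_all _ fun ω => sq_nonneg _)
      ((integrable_const _).add (h2.const_mul _)) (ae_of_all _ fun ω => ?_)
    have h4 := norm_sub_le (z - J x) (t • (v z ω + lam⁻¹ • (z - x)))
    have h5 : t ^ 2 * ‖v z ω + lam⁻¹ • (z - x)‖ ^ 2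
        = ‖t • (v z ω + lam⁻¹ • (z - x))‖ ^ 2 := by
      rw [norm_smul, mul_pow, Real.norm_eq_abs, sq_abs]
    simp only [mul_assoc, h5]
    rw [sub_right_comm]
    set b := ‖t • (v z ω + lam⁻¹ • (z - x))‖
    calc _ ≤ (‖z - J x‖ + b) ^ 2 := by gcongr
      _ ≤ _ := by nlinarith [sq_nonneg (‖z - J x‖ - b)]
  rw [integral_add (integrable_const _) (h2.const_mul _)] at h3
  simp only [integral_const_mul, integral_const, probReal_univ, one_smul] at h3
  have h7 := mul_le_mul_of_nonneg_left (hC x z) (by positivity : 0 ≤ 2 * t ^ 2)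
  linarith

end Oracle

/-! ### The inner scheme -/

/-- Freezing: for `η` independent of `Y` and of law `P`, a bound on the mean of `F y η` for every
fixed `y` may be integrated over the law of `Y`. -/
lemma integral_le_of_indepFun {S Ω β : Type*} [MeasurableSpace S] [MeasurableSpace Ω]
    [MeasurableSpace β] {μ : Measure S} [IsProbabilityMeasure μ] {P : Measure Ω}
    [IsProbabilityMeasure P] {Y : S → β} {η : S → Ω} (hY : Measurable Y) (hη : Measurable η)
    (hlaw : μ.map η = P) (hind : IndepFun Y η μ) {F : β → Ω → ℝ}
    (hF : Measurable (Function.uncurry F)) (hF0 : ∀ y ω, 0 ≤ F y ω)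
    (hFi : ∀ y, Integrable (F y) P) {b : β → ℝ} (hb : ∀ y, ∫ ω, F y ω ∂P ≤ b y)
    (hbi : Integrable (fun s => b (Y s)) μ) :
    Integrable (fun s => F (Y s) (η s)) μ ∧ ∫ s, F (Y s) (η s) ∂μ ≤ ∫ s, b (Y s) ∂μ := by
  have hb0 : ∀ y, 0 ≤ b y := fun y => (integral_nonneg (hF0 y)).trans (hb y)
  have hm : Measurable fun s => F (Y s) (η s) := hF.comp (hY.prodMk hη)
  have hF' : Measurable fun q : β × Ω => ENNReal.ofReal (F q.1 q.2) := hF.ennreal_ofReal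
  have h1 : ∫⁻ s, ENNReal.ofReal (F (Y s) (η s)) ∂μ ≤ ENNReal.ofReal (∫ s, b (Y s) ∂μ) := by
    calc ∫⁻ s, ENNReal.ofReal (F (Y s) (η s)) ∂μ
        = ∫⁻ q, ENNReal.ofReal (F q.1 q.2) ∂(μ.map fun s => (Y s, η s)) :=
          (lintegral_map hF' (hY.prodMk hη)).symm
      _ = ∫⁻ q, ENNReal.ofReal (F q.1 q.2) ∂((μ.map Y).prod P) := by
          rw [(indepFun_iff_map_prod_eq_prod_map_map hY.aemeasurable hη.aemeasurable).1 hind, hlaw]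
      _ = ∫⁻ y, ∫⁻ ω, ENNReal.ofReal (F y ω) ∂P ∂(μ.map Y) := lintegral_prod _ hF'.aemeasurable
      _ = ∫⁻ s, ∫⁻ ω, ENNReal.ofReal (F (Y s) ω) ∂P ∂μ :=
          lintegral_map hF'.lintegral_prod_right' hY
      _ ≤ ∫⁻ s, ENNReal.ofReal (b (Y s)) ∂μ := by
          refine lintegral_mono fun s => ?_
          rw [← ofReal_integral_eq_lintegral_ofReal (hFi _) (ae_of_all _ (hF0 _))]
          exact ENNReal.ofReal_le_ofReal (hb _)
      _ = _ := (ofReal_integral_eq_lintegral_ofReal hbi (ae_of_all _ fun s => hb0 _)).symm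
  have hi : Integrable (fun s => F (Y s) (η s)) μ := by
    refine ⟨hm.aestronglyMeasurable, ?_⟩
    rw [hasFiniteIntegral_iff_ofReal (ae_of_all _ fun s => hF0 _ _)]
    exact h1.trans_lt ENNReal.ofReal_lt_top
  refine ⟨hi, ?_⟩
  rw [← ofReal_integral_eq_lintegral_ofReal hi (ae_of_all _ fun s => hF0 _ _)] at h1
  exact (ENNReal.ofReal_le_ofReal_iff (integral_nonneg fun s => hb0 _)).1 h1

section Inner

variable {Ω E : Type*} [MeasurableSpace Ω] [NormedAddCommGroup E] [InnerProductSpace ℝ E]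
  [FiniteDimensional ℝ E] [MeasurableSpace E] [BorelSpace E]

lemma measurable_innerSA {v : E → Ω → E} (hv : Measurable (Function.uncurry v)) {S : Type*}
    {m : MeasurableSpace S} (lam : ℝ) (α : ℕ → ℝ) {X : S → E} (hX : Measurable X)
    {η : ℕ → S → Ω} (j : ℕ) (hη : ∀ i < j, Measurable (η i)) :
    Measurable fun s => innerSA v lam α (X s) (fun i => η i s) j := by
  induction j with
  | zero => simpa [innerSA] using hX
  | succ j ih =>
    have h1 := ih fun i hi => hη i (by omega)
    have h2 : Measurable fun s =>
        v (innerSA v lam α (X s) (fun i => η i s) j) (η j s) :=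
      hv.comp (h1.prodMk (hη j (by omega)))
    simp only [innerSA]
    exact h1.sub ((h2.add ((h1.sub hX).const_smul _)).const_smul _)

variable {P : Measure Ω} [IsProbabilityMeasure P]
  {Φ : E → Ω → Set E} {v : E → Ω → E} {M₁ M₂ : ℝ}

/-- The mean square error of the inner scheme after `j` steps is `O(1 / j)`, relative to the
second moment of the starting point; the constant depends neither on the starting point nor on
the samples. -/
lemma IsStochasticOracle.exists_innerSA_rate (hv : IsStochasticOracle P Φ v M₁ M₂)
    (hT : IsMonotoneMap (expectedMap P Φ)) {lam : ℝ} (hlam : 0 < lam) {J : E → E}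
    (hJ : ∀ x, lam⁻¹ • (x - J x) ∈ expectedMap P Φ (J x)) {p : E} (hp : J p = p)
    {θ : ℝ} (hθ : lam < 2 * θ) {α : ℕ → ℝ} (hα : ∀ j : ℕ, 1 ≤ j → α j = θ / (j : ℝ))
    {S : Type*} [MeasurableSpace S] (μ : Measure S) [IsProbabilityMeasure μ] :
    ∃ K : ℝ, 0 ≤ K ∧ ∀ (X : S → E) (η : ℕ → S → Ω), Measurable X → (∀ j, Measurable (η j)) →
      (∀ j, μ.map (η j) = P) →
      (∀ j, IndepFun (fun s => (X s, innerSA v lam α (X s) (fun i => η i s) j)) (η j) μ) →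
      Integrable (fun s => ‖X s - p‖ ^ 2) μ → ∀ j,
        Integrable (fun s => ‖innerSA v lam α (X s) (fun i => η i s) j - J (X s)‖ ^ 2) μ ∧
        (1 ≤ j → ∫ s, ‖innerSA v lam α (X s) (fun i => η i s) j - J (X s)‖ ^ 2 ∂μ
          ≤ K * (1 + ∫ s, ‖X s - p‖ ^ 2 ∂μ) / j) := by
  have hfirm := resolvent_firmly_nonexpansive hT hlam hJ
  have hne := norm_sub_le_of_firmly_nonexpansive hfirm
  have hJm : Measurable J := (continuous_of_firmly_nonexpansive hfirm).measurable
  obtain ⟨C, hC0, hC⟩ := hv.exists_second_moment_direction (J := J) (p := p)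
    (fun x => by simpa only [hp] using hne x p) lam
  have hθ0 : 0 < θ := by linarith
  -- the constant of the recursion also has to absorb the step with steplength `α 0`
  set C' : ℝ := C * θ ^ 2 + (2 + 2 * α 0 ^ 2 * C + 2 * α 0 ^ 2 * C) with hC'
  obtain ⟨K, hK0, hK⟩ := exists_rate_of_recursion (c := 2 * θ / lam) (C := C')
    ((one_lt_div hlam).2 hθ) (by positivity)
  refine ⟨K, hK0, fun X η hX hη hlaw hind hXi => ?_⟩
  set Z : ℕ → S → E := fun j s => innerSA v lam α (X s) (fun i => η i s) j with hZ
  have hZm : ∀ j, Measurable (Z j) := fun j =>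
    measurable_innerSA hv.measurable lam α hX j fun i _ => hη i
  set D : ℝ := 1 + ∫ s, ‖X s - p‖ ^ 2 ∂μ with hD
  have hD0 : 0 ≤ D := by
    have : 0 ≤ ∫ s, ‖X s - p‖ ^ 2 ∂μ := integral_nonneg fun s => sq_nonneg _
    linarith
  -- a bound for fixed arguments passes to the iterates
  have hpass : ∀ j, ∀ A B : ℝ, Integrable (fun s => ‖Z j s - J (X s)‖ ^ 2) μ →
      (∀ x z, ∫ ω, ‖z - α j • (v z ω + lam⁻¹ • (z - x)) - J x‖ ^ 2 ∂P
        ≤ A * ‖z - J x‖ ^ 2 + B * (1 + ‖x - p‖ ^ 2)) →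
      Integrable (fun s => ‖Z (j + 1) s - J (X s)‖ ^ 2) μ ∧
        ∫ s, ‖Z (j + 1) s - J (X s)‖ ^ 2 ∂μ ≤ A * ∫ s, ‖Z j s - J (X s)‖ ^ 2 ∂μ + B * D := by
    intro j A B hi hAB
    have hi2 : Integrable (fun s => 1 + ‖X s - p‖ ^ 2) μ := (integrable_const _).add hXi
    have hmeas : Measurable (Function.uncurry fun (q : E × E) (ω : Ω) =>
        ‖q.2 - α j • (v q.2 ω + lam⁻¹ • (q.2 - q.1)) - J q.1‖ ^ 2) := by
      have h1 : Measurable fun q : (E × E) × Ω => v q.1.2 q.2 :=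
        hv.measurable.comp (measurable_fst.snd.prodMk measurable_snd)
      have h2 : Measurable fun q : (E × E) × Ω => q.1.1 := measurable_fst.fst
      have h3 : Measurable fun q : (E × E) × Ω => q.1.2 := measurable_fst.snd
      exact (((h3.sub ((h1.add ((h3.sub h2).const_smul _)).const_smul _)).sub
        (hJm.comp h2)).norm).pow_const 2
    have h := integral_le_of_indepFun (P := P) (hX.prodMk (hZm j)) (hη j) (hlaw j) (hind j)
      (F := fun q ω => ‖q.2 - α j • (v q.2 ω + lam⁻¹ • (q.2 - q.1)) - J q.1‖ ^ 2) hmeas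
      (fun _ _ => sq_nonneg _) (fun q => by
        have hm := ((memLp_const (q.2 - J q.1)).sub
          ((hv.memLp_direction q.2 (lam⁻¹ • (q.2 - q.1))).const_smul (α j)))
        have := (memLp_two_iff_integrable_sq_norm hm.1).1 hm
        refine this.congr (ae_of_all _ fun ω => ?_)
        simp only [Pi.sub_apply, Pi.smul_apply]
        rw [sub_right_comm])
      (b := fun q => A * ‖q.2 - J q.1‖ ^ 2 + B * (1 + ‖q.1 - p‖ ^ 2))
      (fun q => hAB q.1 q.2) ((hi.const_mul A).add (hi2.const_mul B))
    rw [integral_add (hi.const_mul A) (hi2.const_mul B), integral_const_mul, integral_const_mul,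
      integral_add (integrable_const _) hXi] at h
    simp only [integral_const, probReal_univ, one_smul] at h
    exact h
  have hint : ∀ j, Integrable (fun s => ‖Z j s - J (X s)‖ ^ 2) μ := by
    intro j
    induction j with
    | zero =>
      refine hXi.mono' (((hX.sub (hJm.comp hX)).norm.pow_const 2).aestronglyMeasurable)
        (ae_of_all _ fun s => ?_)
      rw [Real.norm_of_nonneg (sq_nonneg _)]
      have := hfirm (X s) p
      rw [hp, sub_self, sub_zero] at this
      change ‖X s - J (X s)‖ ^ 2 ≤ _
      linarith [sq_nonneg ‖J (X s) - p‖]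
    | succ j ih => exact (hpass j _ _ ih (hv.integral_step_le_crude hC (α j))).1
  have hzero : ∫ s, ‖Z 0 s - J (X s)‖ ^ 2 ∂μ ≤ D := by
    have : ∫ s, ‖Z 0 s - J (X s)‖ ^ 2 ∂μ ≤ ∫ s, ‖X s - p‖ ^ 2 ∂μ := by
      refine integral_mono (hint 0) hXi fun s => ?_
      have := hfirm (X s) p
      rw [hp, sub_self, sub_zero] at this
      change ‖X s - J (X s)‖ ^ 2 ≤ _
      linarith [sq_nonneg ‖J (X s) - p‖]
    linarith
  refine fun j => ⟨hint j, fun hj => ?_⟩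
  refine hK D hD0 (fun j => ∫ s, ‖Z j s - J (X s)‖ ^ 2 ∂μ)
    (fun j => integral_nonneg fun s => sq_nonneg _) ?_ (fun j hj => ?_) j hj
  · have h1 := (hpass 0 _ _ (hint 0) (hv.integral_step_le_crude hC (α 0))).2
    have h2 : (2 + 2 * α 0 ^ 2 * C) * ∫ s, ‖Z 0 s - J (X s)‖ ^ 2 ∂μ
        ≤ (2 + 2 * α 0 ^ 2 * C) * D := by gcongr
    have h3 : 0 ≤ C * θ ^ 2 * D := by positivity
    rw [hC']
    simp only [zero_add] at h1
    linarith
  · have hj0 : (0 : ℝ) < j := by exact_mod_cast hj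
    have hstep := hv.integral_step_le hT hJ hC (t := α j) (by rw [hα j hj]; positivity)
    have h1 := (hpass j _ _ (hint j) hstep).2
    have h2 : C * α j ^ 2 ≤ C' / (j : ℝ) ^ 2 := by
      rw [hα j hj, div_pow, ← mul_div_assoc]
      gcongr
      rw [hC']
      have : 0 ≤ 2 + 2 * α 0 ^ 2 * C + 2 * α 0 ^ 2 * C := by positivity
      linarith
    have h3 : 2 * α j / lam = 2 * θ / lam / j := by
      rw [hα j hj]; field_simp
    have h4 : 0 ≤ ∫ s, ‖Z j s - J (X s)‖ ^ 2 ∂μ := integral_nonneg fun s => sq_nonneg _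
    refine h1.trans ?_
    rw [h3]
    gcongr

end Inner

/-! ### The outer scheme -/

section Outer

variable {Ω E : Type*} [MeasurableSpace Ω] [NormedAddCommGroup E] [InnerProductSpace ℝ E]
  [FiniteDimensional ℝ E] [MeasurableSpace E] [BorelSpace E]

/-- The σ-algebra generated by the samples drawn before the `j`-th inner step of the `k`-th outer
iteration; samples that the scheme skips are included. -/
abbrev pastSamples {S : Type*} (ξ : ℕ → ℕ → S → Ω) (k j : ℕ) : MeasurableSpace S :=
  ⨆ q ∈ {q : ℕ × ℕ | q.1 < k ∨ q.1 = k ∧ q.2 < j},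
    MeasurableSpace.comap (ξ q.1 q.2) inferInstance

lemma measurable_pastSamples {S : Type*} (ξ : ℕ → ℕ → S → Ω) {k j i l : ℕ}
    (h : i < k ∨ i = k ∧ l < j) : Measurable[pastSamples ξ k j] (ξ i l) :=
  measurable_iff_comap_le.2 (le_biSup
    (fun q : ℕ × ℕ => MeasurableSpace.comap (ξ q.1 q.2) inferInstance)
    (show (i, l) ∈ {q : ℕ × ℕ | q.1 < k ∨ q.1 = k ∧ q.2 < j} from h))

lemma pastSamples_mono {S : Type*} (ξ : ℕ → ℕ → S → Ω) {k j k' j' : ℕ}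
    (h : k < k' ∨ k = k' ∧ j ≤ j') : pastSamples ξ k j ≤ pastSamples ξ k' j' :=
  biSup_mono fun q hq => by
    simp only [Set.mem_ofPred_eq] at hq ⊢
    omega

lemma measurable_vrSPP {v : E → Ω → E} (hv : Measurable (Function.uncurry v)) {S : Type*}
    (lam : ℝ) (α : ℕ → ℝ) (N : ℕ → ℕ) (x₀ : E) (ξ : ℕ → ℕ → S → Ω) (k : ℕ) :
    Measurable[pastSamples ξ k 0] fun s => vrSPP v lam α N x₀ (fun i j => ξ i j s) k := by
  induction k with
  | zero => exact @measurable_const _ _ _ (pastSamples ξ 0 0) x₀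
  | succ k ih =>
    exact measurable_innerSA (m := pastSamples ξ (k + 1) 0) hv lam α
      (ih.mono (pastSamples_mono ξ (by omega)) le_rfl) (N k)
      (fun i _ => measurable_pastSamples ξ (by omega))

/-- The iterates are independent of the next sample. -/
lemma indepFun_vrSPP {v : E → Ω → E} (hv : Measurable (Function.uncurry v)) {S : Type*}
    [MeasurableSpace S] {μ : Measure S} {ξ : ℕ → ℕ → S → Ω} (hξ : ∀ k j, Measurable (ξ k j))
    (hindep : iIndepFun (fun p : ℕ × ℕ => ξ p.1 p.2) μ) (lam : ℝ) (α : ℕ → ℝ) (N : ℕ → ℕ) (x₀ : E)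
    (k j : ℕ) :
    IndepFun (fun s => (vrSPP v lam α N x₀ (fun i j => ξ i j s) k,
      innerSA v lam α (vrSPP v lam α N x₀ (fun i j => ξ i j s) k) (fun i => ξ k i s) j))
      (ξ k j) μ := by
  have hX : Measurable[pastSamples ξ k j] fun s => vrSPP v lam α N x₀ (fun i j => ξ i j s) k :=
    (measurable_vrSPP hv lam α N x₀ ξ k).mono (pastSamples_mono ξ (by omega)) le_rfl
  have hZ := measurable_innerSA (m := pastSamples ξ k j) hv lam α hX j (η := ξ k)
    (fun i hi => measurable_pastSamples ξ (by omega))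
  have hdisj : Disjoint {q : ℕ × ℕ | q.1 < k ∨ q.1 = k ∧ q.2 < j} {(k, j)} := by
    simp
  have h := indep_iSup_of_disjoint (fun q : ℕ × ℕ => (hξ q.1 q.2).comap_le) hindep hdisj
  rw [IndepFun_iff_Indep]
  refine indep_of_indep_of_le_left (indep_of_indep_of_le_right h ?_)
    (measurable_iff_comap_le.1 (hX.prodMk hZ))
  exact le_biSup (fun q : ℕ × ℕ => MeasurableSpace.comap (ξ q.1 q.2) inferInstance)
    (Set.mem_singleton (k, j))

variable {P : Measure Ω} [IsProbabilityMeasure P]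
  {Φ : E → Ω → Set E} {v : E → Ω → E} {M₁ M₂ : ℝ}

/-- The errors of the inexact resolvents are almost surely summable. The second moments of the
iterates satisfy a recursion with summable relative increments, hence are bounded, and the mean
errors are then of the order of the summable sequence `(k + 1) ^ (-a)`. -/
lemma IsStochasticOracle.ae_summable_error (hv : IsStochasticOracle P Φ v M₁ M₂)
    (hT : IsMonotoneMap (expectedMap P Φ)) {lam : ℝ} (hlam : 0 < lam) {J : E → E}
    (hJ : ∀ x, lam⁻¹ • (x - J x) ∈ expectedMap P Φ (J x)) {p : E} (hp : J p = p)
    {S : Type*} [MeasurableSpace S] (μ : Measure S) [IsProbabilityMeasure μ]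
    {ξ : ℕ → ℕ → S → Ω} (hξ : ∀ k j, Measurable (ξ k j)) (hlaw : ∀ k j, μ.map (ξ k j) = P)
    (hindep : iIndepFun (fun p : ℕ × ℕ => ξ p.1 p.2) μ)
    {θ : ℝ} (hθ : lam < 2 * θ) {α : ℕ → ℝ} (hα : ∀ j : ℕ, 1 ≤ j → α j = θ / (j : ℝ))
    {a : ℝ} (ha : 1 < a) {N : ℕ → ℕ}
    (hN : ∀ k : ℕ, 0 < k → N k = ⌈((k : ℝ) + 1) ^ (2 * a)⌉₊) (x₀ : E) :
    ∀ᵐ s ∂μ, Summable fun k => ‖vrSPP v lam α N x₀ (fun i j => ξ i j s) (k + 1)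
      - J (vrSPP v lam α N x₀ (fun i j => ξ i j s) k)‖ := by
  have hfirm := resolvent_firmly_nonexpansive hT hlam hJ
  have hne := norm_sub_le_of_firmly_nonexpansive hfirm
  have hJm : Measurable J := (continuous_of_firmly_nonexpansive hfirm).measurable
  obtain ⟨K, hK0, hK⟩ := hv.exists_innerSA_rate hT hlam hJ hp hθ hα μ
  set X : ℕ → S → E := fun k s => vrSPP v lam α N x₀ (fun i j => ξ i j s) k with hXdef
  have hpast : ∀ k, pastSamples ξ k 0 ≤ ‹MeasurableSpace S› := fun k =>
    iSup₂_le fun q _ => (hξ q.1 q.2).comap_le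
  have hX : ∀ k, Measurable (X k) := fun k =>
    (measurable_vrSPP hv.measurable lam α N x₀ ξ k).mono (hpast k) le_rfl
  have hXe : ∀ k, Measurable fun s => X (k + 1) s - J (X k s) := fun k =>
    (hX (k + 1)).sub (hJm.comp (hX k))
  have herr : ∀ k, Integrable (fun s => ‖X k s - p‖ ^ 2) μ →
      Integrable (fun s => ‖X (k + 1) s - J (X k s)‖ ^ 2) μ ∧
      (1 ≤ N k → ∫ s, ‖X (k + 1) s - J (X k s)‖ ^ 2 ∂μ
        ≤ K * (1 + ∫ s, ‖X k s - p‖ ^ 2 ∂μ) / N k) := fun k hi =>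
    hK (X k) (ξ k) (hX k) (hξ k) (hlaw k)
      (fun j => indepFun_vrSPP hv.measurable hξ hindep lam α N x₀ k j) hi (N k)
  have hyoung : ∀ k s, ∀ t : ℝ, 0 < t → ‖X (k + 1) s - p‖ ^ 2
      ≤ (1 + t) * ‖X k s - p‖ ^ 2 + (1 + t⁻¹) * ‖X (k + 1) s - J (X k s)‖ ^ 2 := by
    intro k s t ht
    have h1 := hne (X k s) p
    rw [hp] at h1
    have h2 : ‖X (k + 1) s - p‖ ≤ ‖X k s - p‖ + ‖X (k + 1) s - J (X k s)‖ := by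
      have := norm_sub_le_norm_sub_add_norm_sub (X (k + 1) s) (J (X k s)) p
      linarith
    set d := ‖X k s - p‖
    set e := ‖X (k + 1) s - J (X k s)‖
    have h3 : (1 + t) * d ^ 2 + (1 + t⁻¹) * e ^ 2 - (d + e) ^ 2 = t⁻¹ * (t * d - e) ^ 2 := by
      field_simp; ring
    have h4 : 0 ≤ t⁻¹ * (t * d - e) ^ 2 := by positivity
    have h5 : ‖X (k + 1) s - p‖ ^ 2 ≤ (d + e) ^ 2 := by gcongr
    linarith
  have hint : ∀ k, Integrable (fun s => ‖X k s - p‖ ^ 2) μ := by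
    intro k
    induction k with
    | zero => exact integrable_const (‖x₀ - p‖ ^ 2)
    | succ k ih =>
      refine ((ih.const_mul (1 + 1)).add ((herr k ih).1.const_mul (1 + 1⁻¹))).mono'
        (((hX (k + 1)).sub_const p).norm.pow_const 2).aestronglyMeasurable
        (ae_of_all _ fun s => ?_)
      rw [Real.norm_of_nonneg (sq_nonneg _)]
      exact hyoung k s 1 one_pos
  set D : ℕ → ℝ := fun k => 1 + ∫ s, ‖X k s - p‖ ^ 2 ∂μ with hD
  have hD1 : ∀ k, 1 ≤ D k := fun k => by
    have : 0 ≤ ∫ s, ‖X k s - p‖ ^ 2 ∂μ := integral_nonneg fun s => sq_nonneg _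
    simp only [hD]; linarith
  set r : ℕ → ℝ := fun k => (((k : ℝ) + 1) ^ a)⁻¹ with hr
  have hr0 : ∀ k, 0 < r k := fun k => by positivity
  have hr1 : ∀ k, r k ≤ 1 := fun k =>
    inv_le_one_of_one_le₀ (Real.one_le_rpow (by linarith [Nat.cast_nonneg (α := ℝ) k])
      (by linarith))
  have hrsum : Summable r := by
    have := (summable_nat_add_iff 1).2 (Real.summable_nat_rpow_inv.2 ha)
    simpa [hr] using this
  have hNr : ∀ k, 0 < k → 1 ≤ N k ∧ (N k : ℝ)⁻¹ ≤ r k ^ 2 := by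
    intro k hk
    have h1 : (0 : ℝ) < ((k : ℝ) + 1) ^ (2 * a) := by positivity
    have h2 : ((k : ℝ) + 1) ^ (2 * a) ≤ N k := by rw [hN k hk]; exact Nat.le_ceil _
    have h3 : r k ^ 2 = (((k : ℝ) + 1) ^ (2 * a))⁻¹ := by
      rw [hr, inv_pow, ← Real.rpow_natCast, ← Real.rpow_mul (by positivity), mul_comm a]
      norm_num
    refine ⟨?_, ?_⟩
    · exact_mod_cast h1.trans_le h2
    · rw [h3]; gcongr
  have herr2 : ∀ k, 0 < k →
      ∫ s, ‖X (k + 1) s - J (X k s)‖ ^ 2 ∂μ ≤ K * D k * r k ^ 2 := by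
    intro k hk
    refine ((herr k (hint k)).2 (hNr k hk).1).trans ?_
    have := hD1 k
    rw [div_eq_mul_inv]
    exact mul_le_mul_of_nonneg_left (hNr k hk).2 (mul_nonneg hK0 (by linarith))
  -- Young's inequality with parameter `r k` balances the two terms of the recursion
  have hrec : ∀ k, 0 < k → D (k + 1) ≤ (1 + (1 + 2 * K) * r k) * D k := by
    intro k hk
    have h1 : ∫ s, ‖X (k + 1) s - p‖ ^ 2 ∂μ ≤ (1 + r k) * ∫ s, ‖X k s - p‖ ^ 2 ∂μ
        + (1 + (r k)⁻¹) * ∫ s, ‖X (k + 1) s - J (X k s)‖ ^ 2 ∂μ := by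
      rw [← integral_const_mul, ← integral_const_mul,
        ← integral_add ((hint k).const_mul _) ((herr k (hint k)).1.const_mul _)]
      exact integral_mono (hint (k + 1))
        (((hint k).const_mul _).add ((herr k (hint k)).1.const_mul _))
        fun s => hyoung k s (r k) (hr0 k)
    have h2 : (1 + (r k)⁻¹) * ∫ s, ‖X (k + 1) s - J (X k s)‖ ^ 2 ∂μ
        ≤ (1 + (r k)⁻¹) * (K * D k * r k ^ 2) := by
      have := hr0 k
      exact mul_le_mul_of_nonneg_left (herr2 k hk) (by positivity)
    have h3 : (1 + (r k)⁻¹) * (K * D k * r k ^ 2) = K * D k * (r k ^ 2 + r k) := by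
      have := (hr0 k).ne'
      field_simp
    have h4 : K * D k * (r k ^ 2 + r k) ≤ K * D k * (2 * r k) := by
      have := hD1 k
      refine mul_le_mul_of_nonneg_left ?_ (mul_nonneg hK0 (by linarith))
      nlinarith [hr0 k, hr1 k]
    have h5 : ∫ s, ‖X k s - p‖ ^ 2 ∂μ = D k - 1 := by simp only [hD]; ring
    have h6 : D (k + 1) = 1 + ∫ s, ‖X (k + 1) s - p‖ ^ 2 ∂μ := rfl
    rw [h5] at h1
    nlinarith [hr0 k]
  obtain ⟨B, hB⟩ := bounded_of_le_one_add_mul (D := fun k => D (k + 1))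
    (s := fun k => (1 + 2 * K) * r (k + 1))
    (fun k => mul_nonneg (by positivity) (hr0 _).le)
    (((summable_nat_add_iff 1).2 hrsum).mul_left _) (by linarith [hD1 1])
    (fun k => hrec (k + 1) k.succ_pos)
  have hmean : ∀ k, ∫ s, ‖X (k + 1 + 1) s - J (X (k + 1) s)‖ ∂μ
      ≤ (1 + K * B) / 2 * r (k + 1) := by
    intro k
    have hpos := hr0 (k + 1)
    have hi := (herr (k + 1) (hint (k + 1))).1
    have h1 : ∫ s, ‖X (k + 1 + 1) s - J (X (k + 1) s)‖ ∂μ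
        ≤ ∫ s, (r (k + 1) / 2
          + (2 * r (k + 1))⁻¹ * ‖X (k + 1 + 1) s - J (X (k + 1) s)‖ ^ 2) ∂μ := by
      refine integral_mono_of_nonneg (ae_of_all _ fun s => norm_nonneg _)
        ((integrable_const _).add (hi.const_mul _)) (ae_of_all _ fun s => ?_)
      simp only
      set e := ‖X (k + 1 + 1) s - J (X (k + 1) s)‖
      have h2 : r (k + 1) / 2 + (2 * r (k + 1))⁻¹ * e ^ 2 - e
          = (2 * r (k + 1))⁻¹ * (r (k + 1) - e) ^ 2 := by
        field_simp; ring
      have h3 : 0 ≤ (2 * r (k + 1))⁻¹ * (r (k + 1) - e) ^ 2 := by positivity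
      linarith
    rw [integral_add (integrable_const _) (hi.const_mul _), integral_const_mul] at h1
    simp only [integral_const, probReal_univ, one_smul] at h1
    have h4 : ∫ s, ‖X (k + 1 + 1) s - J (X (k + 1) s)‖ ^ 2 ∂μ ≤ K * B * r (k + 1) ^ 2 :=
      (herr2 (k + 1) k.succ_pos).trans (by gcongr; exact hB k)
    have h5 := mul_le_mul_of_nonneg_left h4 (by positivity : 0 ≤ (2 * r (k + 1))⁻¹)
    have h6 : (2 * r (k + 1))⁻¹ * (K * B * r (k + 1) ^ 2) = K * B / 2 * r (k + 1) := by
      field_simp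
    linarith
  have hsum : ∀ᵐ s ∂μ, Summable fun k => ‖X (k + 1 + 1) s - J (X (k + 1) s)‖ := by
    refine summable_norm_of_tsum_eLpNorm_ne_top le_rfl
      (fun k => (hXe (k + 1)).aestronglyMeasurable) ?_
    have hs : Summable fun k => (1 + K * B) / 2 * r (k + 1) :=
      ((summable_nat_add_iff 1).2 hrsum).mul_left _
    refine ne_top_of_le_ne_top hs.tsum_ofReal_ne_top (ENNReal.tsum_le_tsum fun k => ?_)
    have hi : Integrable (fun s => X (k + 1 + 1) s - J (X (k + 1) s)) μ :=
      ((memLp_two_iff_integrable_sq_norm (hXe (k + 1)).aestronglyMeasurable).2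
        (herr (k + 1) (hint (k + 1))).1).integrable (by norm_num)
    rw [eLpNorm_one_eq_lintegral_enorm, ← ofReal_integral_norm_eq_lintegral_enorm hi]
    exact ENNReal.ofReal_le_ofReal (hmean k)
  filter_upwards [hsum] with s hs
  exact (summable_nat_add_iff 1).1 hs

end Outer

/-! ### Almost sure convergence -/

theorem mainTheorem1 {n : ℕ}
    {Ω : Type*} [MeasurableSpace Ω] (P : Measure Ω) [IsProbabilityMeasure P]
    -- the random set-valued map; `T = expectedMap P Φ` is maximal monotone and has a zero
    (Φ : EuclideanSpace ℝ (Fin n) → Ω → Set (EuclideanSpace ℝ (Fin n)))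
    (hT : IsMaximalMonotoneMap (expectedMap P Φ))
    (hsol : ∃ x, (0 : EuclideanSpace ℝ (Fin n)) ∈ expectedMap P Φ x)
    -- the stochastic first-order oracle
    (v : EuclideanSpace ℝ (Fin n) → Ω → EuclideanSpace ℝ (Fin n)) (M₁ M₂ : ℝ)
    (hv : IsStochasticOracle P Φ v M₁ M₂)
    -- the independent samples drawn by the scheme
    {S : Type*} [MeasurableSpace S] (μ : Measure S) [IsProbabilityMeasure μ]
    (ξ : ℕ → ℕ → S → Ω) (hξ : ∀ k j, Measurable (ξ k j))
    (hlaw : ∀ k j, μ.map (ξ k j) = P)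
    (hindep : iIndepFun (fun p : ℕ × ℕ => ξ p.1 p.2) μ)
    -- proximal parameter, inner steplengths and sample sizes
    (lam : ℝ) (hlam : 0 < lam)
    (θ : ℝ) (hθ : lam < 2 * θ) (α : ℕ → ℝ) (hα : ∀ j : ℕ, 1 ≤ j → α j = θ / (j : ℝ))
    (a : ℝ) (ha : 1 < a)
    (N : ℕ → ℕ) (hN : ∀ k : ℕ, 0 < k → N k = ⌈((k : ℝ) + 1) ^ (2 * a)⌉₊)
    (x₀ : EuclideanSpace ℝ (Fin n)) :
    ∀ᵐ s ∂μ, ∃ xstar : EuclideanSpace ℝ (Fin n),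
      0 ∈ expectedMap P Φ xstar ∧
        Tendsto (fun k => vrSPP v lam α N x₀ (fun i j => ξ i j s) k) atTop (𝓝 xstar) := by
  choose J hJ using fun x => hv.exists_resolvent hT hlam x
  obtain ⟨p, hp⟩ := hsol
  have hJp : J p = p := (resolvent_eq_self_iff hT.1 hlam hJ p).2 hp
  filter_upwards [hv.ae_summable_error hT.1 hlam hJ hJp μ hξ hlaw hindep hθ hα ha hN x₀] with s hs
  obtain ⟨q, hq, hlim⟩ :=
    tendsto_of_summable_error (resolvent_firmly_nonexpansive hT.1 hlam hJ) hJp hs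
  exact ⟨q, (resolvent_eq_self_iff hT.1 hlam hJ q).1 hq, hlim⟩
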